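/- A graphon is a Lebesgue measurable function $w:[0,1]^2\to[0,1]$ with $w(x,y)=w(y,x)$ for almost every $(x,y)$; its degree function is $d_w(x)=\int_0^1 w(x,y)\,dy$. For a measurable set $S\subseteq[0,1]$ of measure $|S|$, let $L_{w,S}$ be the bounded positive semidefinite operator on (complex) $L^2(S)$ given by $(L_{w,S}f)(x)=\int_S w(x,y)(f(x)-f(y))\,dy$, and let $L_w=L_{w,[0,1]}$. For $\gamma>0$ let $PW_\gamma(w)$ be the range of the spectral projection $\mathbf 1_{[0,\gamma]}(L_w)$ on $L^2[0,1]$. For $u:[0,1]^2\to\mathbb R$ bounded and measurable, the cut norm is $\|u\|_\Box=\sup_{S,T}\left|\int_{S\times T}u(x,y)\,dx\,dy\right|$, the supremum being over measurable $S,T\subseteq[0,1]$. Theorem. Let $w$ and $w_n$ ($n\in\mathbb N$) be graphons with $\|w_n-w\|_\Box\to0$ and $\|d_{w_n}-d_w\|_\infty\to0$, where $\|\cdot\|_\infty$ is the norm of $L^\infty[0,1]$. Let $\{S_1,\dots,S_k\}$ be a partition of $[0,1]$ into measurable sets, and for each $j$ let $\psi_j\in L^2(S_j)$ satisfy $\|\psi_j\|=1$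 and $\int_{S_j}\psi_j\ne0$. Suppose that for each $j$ the number $\delta_j>0$ is such that $\|L_{w,S_j}^{1/2}f\|\ge\delta_j\|f\|$ for every $f\in L^2(S_j)$ with $\int_{S_j}f=0$. Put $$\theta=\max_{1\le j\le k}\frac{|S_j|}{\left|\int_{S_j}\psi_j\right|^2},\qquad \delta=\min_{1\le j\le k}\delta_j .$$ Then for every $\gamma$ with $0<\gamma<\delta^2/\theta$ there is an $N\in\mathbb N$ such that for all $n\ge N$ and all $f\in PW_\gamma(w_n)$, $$\frac{(\delta-\sqrt{\theta\gamma})^2}{2\theta\delta^2}\,\|f\|^2\le\sum_{j=1}^k|\langle f,\psi_j\rangle|^2\le\|f\|^2,$$ where $\langle f,\psi_j\rangle=\int_{S_j}f(x)\overline{\psi_j(x)}\,dx$. -/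

import Mathlib

open MeasureTheory Filter Topology
open scoped ENNReal InnerProductSpace unitInterval

noncomputable section

/-! ### Square roots and spectral projections of bounded operators on a Hilbert space -/

/-- The square root `A^{1/2}` of a bounded positive semidefinite operator `A`. -/
def operatorSqrt {H : Type*} [NormedAddCommGroup H] [InnerProductSpace ℂ H] [CompleteSpace H]
    (A : H →L[ℂ] H) : H →L[ℂ] H := CFC.sqrt A

section SpectralProjection

/-- Continuous functions with values in `[0,1]`; for closed nonempty `K`, they decrease pointwise,
as `m → ∞`, to the indicator function of `K`. -/
def closedCutoff (K : Set ℝ) (m : ℕ) (t : ℝ) : ℝ := max 0 (1 - m * Metric.infDist t K)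

theorem continuous_closedCutoff (K : Set ℝ) (m : ℕ) : Continuous (closedCutoff K m) :=
  continuous_const.max
    (continuous_const.sub (continuous_const.mul (Metric.continuous_infDist_pt K)))

theorem closedCutoff_nonneg (K : Set ℝ) (m : ℕ) (t : ℝ) : 0 ≤ closedCutoff K m t :=
  le_max_left _ _

theorem closedCutoff_le_one (K : Set ℝ) (m : ℕ) (t : ℝ) : closedCutoff K m t ≤ 1 :=
  max_le zero_le_one (sub_le_self _ (mul_nonneg m.cast_nonneg Metric.infDist_nonneg))

theorem closedCutoff_anti (K : Set ℝ) {m n : ℕ} (h : m ≤ n) (t : ℝ) :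
    closedCutoff K n t ≤ closedCutoff K m t := by
  have h1 : (m : ℝ) * Metric.infDist t K ≤ n * Metric.infDist t K :=
    mul_le_mul_of_nonneg_right (Nat.cast_le.2 h) Metric.infDist_nonneg
  exact max_le_max le_rfl (by linarith)

theorem tendsto_closedCutoff {K : Set ℝ} (hK : IsClosed K) (hne : K.Nonempty) (t : ℝ) :
    Tendsto (fun m => closedCutoff K m t) atTop (𝓝 (K.indicator (fun _ => 1) t)) := by
  by_cases ht : t ∈ K
  · have : ∀ m, closedCutoff K m t = 1 := fun m => by
      simp [closedCutoff, Metric.infDist_zero_of_mem ht]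
    simp [this, ht]
  · have hpos : 0 < Metric.infDist t K := (hK.notMem_iff_infDist_pos hne).1 ht
    rw [Set.indicator_of_notMem ht]
    obtain ⟨N, hN⟩ := exists_nat_gt (1 / Metric.infDist t K)
    refine tendsto_const_nhds.congr' ?_
    filter_upwards [eventually_ge_atTop N] with m hm
    have h1 : 1 < (N : ℝ) * Metric.infDist t K := by rwa [div_lt_iff₀ hpos] at hN
    have h2 : (N : ℝ) * Metric.infDist t K ≤ m * Metric.infDist t K :=
      mul_le_mul_of_nonneg_right (Nat.cast_le.2 hm) hpos.le
    exact (max_eq_left (by linarith)).symm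

variable {H : Type*} [NormedAddCommGroup H] [InnerProductSpace ℂ H] [CompleteSpace H]

theorem cauchySeq_cfc_closedCutoff (A : H →L[ℂ] H) (K : Set ℝ) (f : H) :
    CauchySeq (fun m => cfc (closedCutoff K m) A f) := by
  by_cases hA : IsSelfAdjoint A
  swap
  · have : ∀ m, cfc (closedCutoff K m) A = 0 := fun m => cfc_apply_of_not_predicate A hA
    simp only [this]
    exact cauchySeq_const _
  have hc : ∀ m, ContinuousOn (closedCutoff K m) (spectrum ℝ A) :=
    fun m => (continuous_closedCutoff K m).continuousOn
  set a : ℕ → ℝ := fun m => (⟪cfc (closedCutoff K m) A f, f⟫_ℂ).re with ha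
  have key : ∀ m n, m ≤ n →
      ‖cfc (closedCutoff K m) A f - cfc (closedCutoff K n) A f‖ ^ 2 ≤ a m - a n := by
    intro m n hmn
    set D := cfc (fun t => closedCutoff K m t - closedCutoff K n t) A with hD
    have hDs : D = cfc (closedCutoff K m) A - cfc (closedCutoff K n) A :=
      cfc_sub _ _ A (hc m) (hc n)
    have hDD : D * D ≤ D := by
      rw [hD, ← cfc_mul (fun t => closedCutoff K m t - closedCutoff K n t)
        (fun t => closedCutoff K m t - closedCutoff K n t) A
        ((hc m).sub (hc n)) ((hc m).sub (hc n))]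
      refine cfc_mono (fun t _ => ?_) (((hc m).sub (hc n)).mul ((hc m).sub (hc n)))
        ((hc m).sub (hc n))
      have h1 := closedCutoff_anti K hmn t
      have h2 := closedCutoff_nonneg K n t
      have h3 := closedCutoff_le_one K m t
      nlinarith
    have hsa : IsSelfAdjoint D := cfc_predicate _ A
    have h1 := ((ContinuousLinearMap.le_def _ _).1 hDD).re_inner_nonneg_left f
    have h2 : ⟪(D * D) f, f⟫_ℂ = ⟪D f, D f⟫_ℂ :=
      hsa.isSymmetric (D f) f
    have h3 : cfc (closedCutoff K m) A f - cfc (closedCutoff K n) A f = D f := by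
      rw [hDs]; rfl
    have h4 : a m - a n = (⟪D f, f⟫_ℂ).re := by
      rw [← h3, inner_sub_left]; simp [ha]
    rw [h3, h4]
    have h5 : (⟪D f, D f⟫_ℂ).re = ‖D f‖ ^ 2 := by
      simpa using inner_self_eq_norm_sq (𝕜 := ℂ) (D f)
    rw [sub_apply, inner_sub_left, h2] at h1
    simp only [map_sub, RCLike.re_to_complex] at h1
    linarith
  have hanti : Antitone a := fun m n hmn => by
    have := key m n hmn
    have := sq_nonneg ‖cfc (closedCutoff K m) A f - cfc (closedCutoff K n) A f‖
    linarith
  have hbdd : BddBelow (Set.range a) := by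
    refine ⟨0, ?_⟩
    rintro _ ⟨m, rfl⟩
    have h0 : 0 ≤ cfc (closedCutoff K m) A := cfc_nonneg fun t _ => closedCutoff_nonneg K m t
    exact ((ContinuousLinearMap.nonneg_iff_isPositive _).1 h0).re_inner_nonneg_left f
  have hcau : CauchySeq a := (tendsto_atTop_ciInf hanti hbdd).cauchySeq
  rw [Metric.cauchySeq_iff'] at hcau ⊢
  intro ε hε
  obtain ⟨N, hN⟩ := hcau (ε ^ 2) (by positivity)
  refine ⟨N, fun n hn => ?_⟩
  have h1 := hN n hn
  have h2 := key N n hn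
  rw [Real.dist_eq, abs_sub_comm] at h1
  rw [dist_eq_norm, norm_sub_rev]
  exact lt_of_pow_lt_pow_left₀ 2 hε.le (h2.trans_lt ((le_abs_self _).trans_lt h1))

theorem exists_strongLimit_closedCutoff (A : H →L[ℂ] H) (K : Set ℝ) :
    ∃ P : H →L[ℂ] H, ∀ f, Tendsto (fun m => cfc (closedCutoff K m) A f) atTop (𝓝 (P f)) := by
  choose F hF using fun f => cauchySeq_tendsto_of_complete (cauchySeq_cfc_closedCutoff A K f)
  exact ⟨continuousLinearMapOfTendsto _ (tendsto_pi_nhds.2 hF), hF⟩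

/-- The spectral projection `𝟏_K(A)` of a bounded self-adjoint operator `A`, for `K ⊆ ℝ` closed
and nonempty. As in the Borel functional calculus, a bounded monotone pointwise limit of functions
corresponds to the strong limit of the operators; `𝟏_K` is the pointwise decreasing limit of the
continuous functions `closedCutoff K m`, to which the continuous functional calculus applies. -/
def spectralProjection (A : H →L[ℂ] H) (K : Set ℝ) : H →L[ℂ] H :=
  (exists_strongLimit_closedCutoff A K).choose

theorem tendsto_spectralProjection (A : H →L[ℂ] H) (K : Set ℝ) (f : H) :
    Tendsto (fun m => cfc (closedCutoff K m) A f) atTop (𝓝 (spectralProjection A K f)) :=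
  (exists_strongLimit_closedCutoff A K).choose_spec f

end SpectralProjection

/-! ### The Laplacian of a kernel -/

section KernelLaplacian

variable {X : Type*} [MeasurableSpace X] {μ : Measure X} [IsFiniteMeasure μ] {w : X × X → ℝ}

theorem integrable_kernel_diff (hw : AEMeasurable w (μ.prod μ)) (hb : ∀ p, w p ∈ Set.Icc 0 1)
    {f : X → ℂ} (hf : Integrable f μ) :
    Integrable (fun p : X × X => (w p : ℂ) * (f p.1 - f p.2)) (μ.prod μ) := by
  refine ((hf.comp_fst μ).sub (hf.comp_snd μ)).bdd_mul (c := 1)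
    (Complex.measurable_ofReal.comp_aemeasurable hw).aestronglyMeasurable ?_
  refine ae_of_all _ fun p => ?_
  rw [Complex.norm_real, Real.norm_eq_abs, abs_of_nonneg (hb p).1]
  exact (hb p).2

theorem norm_kernel_integral_le (hb : ∀ p, w p ∈ Set.Icc 0 1)
    {f : X → ℂ} (hf : Integrable f μ) (x : X) :
    ‖∫ y, (w (x, y) : ℂ) * (f x - f y) ∂μ‖ ≤ ‖(∫ y, ‖f y‖ ∂μ) + μ.real Set.univ * ‖f x‖‖ := by
  have h1 : ∀ y, ‖(w (x, y) : ℂ) * (f x - f y)‖ ≤ ‖f y‖ + ‖f x‖ := fun y => by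
    rw [norm_mul, Complex.norm_real, Real.norm_eq_abs, abs_of_nonneg (hb _).1, add_comm]
    exact (mul_le_of_le_one_left (norm_nonneg _) (hb _).2).trans (norm_sub_le _ _)
  refine (norm_integral_le_of_norm_le (hf.norm.add (integrable_const _))
    (ae_of_all _ h1)).trans ?_
  refine (le_of_eq ?_).trans (le_abs_self _)
  simp only [Pi.add_apply]
  rw [integral_add hf.norm (integrable_const _), integral_const, smul_eq_mul]

theorem memLp_kernel_integral (hw : AEMeasurable w (μ.prod μ)) (hb : ∀ p, w p ∈ Set.Icc 0 1)
    {f : X → ℂ} (hf : MemLp f 2 μ) :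
    MemLp (fun x => ∫ y, (w (x, y) : ℂ) * (f x - f y) ∂μ) 2 μ := by
  have hi : Integrable f μ := hf.integrable one_le_two
  have hg : MemLp (fun x => (∫ y, ‖f y‖ ∂μ) + μ.real Set.univ * ‖f x‖) 2 μ :=
    (memLp_const (∫ y, ‖f y‖ ∂μ)).add (hf.norm.const_mul (μ.real Set.univ))
  have hm : AEStronglyMeasurable (fun x => ∫ y, (w (x, y) : ℂ) * (f x - f y) ∂μ) μ :=
    (integrable_kernel_diff hw hb hi).aestronglyMeasurable.integral_prod_right'
  exact hg.of_le hm (ae_of_all _ (norm_kernel_integral_le hb hi))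

/-- The Laplacian as a linear map on `L²(μ)`; see `kernelLaplacian`. -/
def kernelLaplacianLin (hw : AEMeasurable w (μ.prod μ)) (hb : ∀ p, w p ∈ Set.Icc 0 1) :
    Lp ℂ 2 μ →ₗ[ℂ] Lp ℂ 2 μ where
  toFun f := (memLp_kernel_integral hw hb (Lp.memLp f)).toLp
    (fun x => ∫ y, (w (x, y) : ℂ) * (f x - f y) ∂μ)
  map_add' f g := by
    rw [← MemLp.toLp_add]
    refine MemLp.toLp_congr _ _ ?_
    have hf := (integrable_kernel_diff hw hb
      ((Lp.memLp f).integrable one_le_two)).prod_right_ae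
    have hg := (integrable_kernel_diff hw hb
      ((Lp.memLp g).integrable one_le_two)).prod_right_ae
    filter_upwards [hf, hg, Lp.coeFn_add f g] with x hfx hgx hx
    rw [Pi.add_apply, ← integral_add hfx hgx]
    refine integral_congr_ae ?_
    filter_upwards [Lp.coeFn_add f g] with y hy
    rw [hx, hy, Pi.add_apply, Pi.add_apply]
    ring
  map_smul' c f := by
    rw [RingHom.id_apply, ← MemLp.toLp_const_smul]
    refine MemLp.toLp_congr _ _ ?_
    filter_upwards [Lp.coeFn_smul c f] with x hx
    rw [Pi.smul_apply, smul_eq_mul, ← integral_const_mul]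
    refine integral_congr_ae ?_
    filter_upwards [Lp.coeFn_smul c f] with y hy
    rw [hx, hy, Pi.smul_apply, Pi.smul_apply, smul_eq_mul, smul_eq_mul]
    ring

theorem norm_kernelLaplacianLin_le (hw : AEMeasurable w (μ.prod μ))
    (hb : ∀ p, w p ∈ Set.Icc 0 1) :
    ∃ C : ℝ, ∀ f : Lp ℂ 2 μ, ‖kernelLaplacianLin hw hb f‖ ≤ C * ‖f‖ := by
  have h1 : ∀ f : Lp ℂ 2 μ, ∫ y, ‖f y‖ ∂μ ≤ (μ Set.univ ^ (1 / 2 : ℝ)).toReal * ‖f‖ := by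
    intro f
    have hfm := (Lp.memLp f).aestronglyMeasurable
    rw [integral_norm_eq_lintegral_enorm hfm, ← eLpNorm_one_eq_lintegral_enorm, Lp.norm_def,
      mul_comm, ← ENNReal.toReal_mul]
    refine ENNReal.toReal_mono (ENNReal.mul_ne_top (Lp.memLp f).2.ne
      (ENNReal.rpow_ne_top_of_nonneg (by norm_num) (measure_ne_top μ _))) ?_
    have := eLpNorm_le_eLpNorm_mul_rpow_measure_univ (μ := μ) (f := f) one_le_two hfm
    refine this.trans (le_of_eq ?_)
    norm_num
  refine ⟨(μ Set.univ ^ (1 / 2 : ℝ)).toReal * ‖(Lp.const 2 μ (1 : ℝ) : Lp ℝ 2 μ)‖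
    + μ.real Set.univ, fun f => ?_⟩
  have hn : MemLp (fun x => ‖f x‖) 2 μ := (Lp.memLp f).norm
  set g : Lp ℝ 2 μ := (∫ y, ‖f y‖ ∂μ) • Lp.const 2 μ (1 : ℝ) + μ.real Set.univ • hn.toLp
    with hg
  have hle : ‖kernelLaplacianLin hw hb f‖ ≤ ‖g‖ := by
    refine Lp.norm_le_norm_of_ae_le ?_
    filter_upwards [MemLp.coeFn_toLp (memLp_kernel_integral hw hb (Lp.memLp f)),
      Lp.coeFn_add ((∫ y, ‖f y‖ ∂μ) • Lp.const 2 μ (1 : ℝ)) (μ.real Set.univ • hn.toLp),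
      Lp.coeFn_smul (∫ y, ‖f y‖ ∂μ) (Lp.const 2 μ (1 : ℝ)), Lp.coeFn_const 2 μ (1 : ℝ),
      Lp.coeFn_smul (μ.real Set.univ) hn.toLp, hn.coeFn_toLp] with x hx h2 h3 h4 h5 h6
    have h7 := norm_kernel_integral_le (μ := μ) hb ((Lp.memLp f).integrable one_le_two) x
    rw [hg, h2, Pi.add_apply, h3, h5, Pi.smul_apply, Pi.smul_apply, h4, h6]
    simp only [Function.const_apply, smul_eq_mul, mul_one]
    rw [← hx] at h7
    exact h7
  have hnn : ‖hn.toLp‖ = ‖f‖ := by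
    rw [Lp.norm_toLp, Lp.norm_def, eLpNorm_norm]
  calc ‖kernelLaplacianLin hw hb f‖ ≤ ‖g‖ := hle
    _ ≤ (∫ y, ‖f y‖ ∂μ) * ‖(Lp.const 2 μ (1 : ℝ) : Lp ℝ 2 μ)‖ + μ.real Set.univ * ‖f‖ := by
      refine (norm_add_le _ _).trans (le_of_eq ?_)
      rw [norm_smul, norm_smul, hnn, Real.norm_of_nonneg (integral_nonneg fun _ => norm_nonneg _),
        Real.norm_of_nonneg measureReal_nonneg]
    _ ≤ ((μ Set.univ ^ (1 / 2 : ℝ)).toReal * ‖f‖) * ‖(Lp.const 2 μ (1 : ℝ) : Lp ℝ 2 μ)‖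
        + μ.real Set.univ * ‖f‖ := by
      gcongr
      exact h1 f
    _ = _ := by ring

/-- For a finite measure `μ` and a measurable kernel `w` with values in `[0,1]`, the Laplacian
`(L f)(x) = ∫ w(x,y) (f(x) - f(y)) dμ(y)` as a bounded operator on `L²(μ)`. -/
def kernelLaplacian (hw : AEMeasurable w (μ.prod μ)) (hb : ∀ p, w p ∈ Set.Icc 0 1) :
    Lp ℂ 2 μ →L[ℂ] Lp ℂ 2 μ :=
  (kernelLaplacianLin hw hb).mkContinuousOfExistsBound (norm_kernelLaplacianLin_le hw hb)

theorem kernelLaplacian_ae_eq (hw : AEMeasurable w (μ.prod μ)) (hb : ∀ p, w p ∈ Set.Icc 0 1)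
    (f : Lp ℂ 2 μ) :
    kernelLaplacian hw hb f =ᵐ[μ] fun x => ∫ y, (w (x, y) : ℂ) * (f x - f y) ∂μ :=
  MemLp.coeFn_toLp (memLp_kernel_integral hw hb (Lp.memLp f))

end KernelLaplacian

/-! ### Graphons -/

/-- A graphon: a Lebesgue measurable function `[0,1]² → [0,1]` that is symmetric almost
everywhere (a.e. measurability with respect to Lebesgue measure is Lebesgue measurability). -/
structure Graphon where
  toFun : I × I → ℝ
  aemeasurable : AEMeasurable toFun volume
  mem_Icc : ∀ p, toFun p ∈ Set.Icc (0 : ℝ) 1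
  symm : ∀ᵐ p : I × I, toFun p.swap = toFun p

namespace Graphon

theorem aemeasurable_restrict (w : Graphon) (S : Set I) :
    AEMeasurable w.toFun ((volume.restrict S).prod (volume.restrict S)) := by
  rw [Measure.prod_restrict]
  exact w.aemeasurable.restrict

/-- The Laplacian `L_w` on `L²[0,1]`. -/
def laplacian (w : Graphon) :
    Lp ℂ 2 (volume : Measure I) →L[ℂ] Lp ℂ 2 (volume : Measure I) :=
  kernelLaplacian (μ := volume) w.aemeasurable w.mem_Icc

/-- The Laplacian on `L²(S)` of the restriction of `w` to `S × S`:
`(L f)(x) = ∫_S w(x,y) (f(x) - f(y)) dy`. -/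
def laplacianOn (w : Graphon) (S : Set I) :
    Lp ℂ 2 (volume.restrict S) →L[ℂ] Lp ℂ 2 (volume.restrict S) :=
  kernelLaplacian (w.aemeasurable_restrict S) w.mem_Icc

/-- The degree function `d_w(x) = ∫ w(x,y) dy`. -/
def degree (w : Graphon) (x : I) : ℝ := ∫ y, w.toFun (x, y)

/-- The Paley-Wiener space `PW_γ(w)`, the range of the spectral projection `𝟏_{[0,γ]}(L_w)`. -/
def paleyWiener (w : Graphon) (γ : ℝ) : Submodule ℂ (Lp ℂ 2 (volume : Measure I)) :=
  LinearMap.range (spectralProjection w.laplacian (Set.Icc 0 γ)).toLinearMap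

end Graphon

/-- The cut norm `sup_{S,T} |∫_{S × T} u|` over measurable `S, T ⊆ [0,1]`. -/
def cutNorm (u : I × I → ℝ) : ℝ :=
  sSup {r | ∃ S T : Set I, MeasurableSet S ∧ MeasurableSet T ∧ r = |∫ p in S ×ˢ T, u p|}

/-- The constant `θ_S = |S| / |∫_S ψ|²`. -/
def samplingConst (S : Set I) (ψ : Lp ℂ 2 (volume.restrict S)) : ℝ :=
  volume.real S / ‖∫ x in S, ψ x‖ ^ 2

/-- The sample `⟨f, ψ⟩ = ∫_S f(x) conj(ψ(x)) dx` of `f ∈ L²[0,1]` against `ψ ∈ L²(S)`. -/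
def sample (S : Set I) (f : Lp ℂ 2 (volume : Measure I)) (ψ : Lp ℂ 2 (volume.restrict S)) : ℂ :=
  ∫ x in S, f x * starRingEnd ℂ (ψ x)

end

open MeasureTheory Filter Topology
open scoped ENNReal InnerProductSpace unitInterval

noncomputable section

/-! ### Quadratic forms, spectral projections and the sampling estimate on one block -/

section HilbertSpace

variable {H : Type*} [NormedAddCommGroup H] [InnerProductSpace ℂ H] [CompleteSpace H]

/-! No convergence of the spectral projections of `w_n` is needed: a one-sided comparison of
quadratic forms suffices. A function in `PW_γ(w_n)` has Rayleigh quotient at most `γ` for `L_{w_n}`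
(`re_inner_le_of_mem_range_spectralProjection`). If `⟨L_w f, f⟩ ≤ ⟨L_{w_n} f, f⟩ + ε‖f‖²` for all
`f` and all large `n`, then its Rayleigh quotient for the fixed graphon `w` is at most `γ + ε`, and
the sampling inequality can be proved for `w` alone. The factor 2 in the lower frame bound absorbs
`ε`.

Comparison of forms (`Graphon.re_inner_laplacian_le_add`): `⟨L_w f, f⟩` is half the Dirichlet
energy, so the difference of the forms is half the energy of the signed kernel `u = w_n - w`.
Expanding `|f(x) - f(y)|²`, the two diagonal terms see only the degree function of `u`, while the
cross terms are bilinear forms on `L²`. After truncating `f`, the latter are controlled by the cut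
norm (`abs_integral_kernel_quadratic_le`).

Sampling for one graphon (`Graphon.sampling_lower_bound`): on a block `S_j`, the Poincaré hypothesis
bounds `‖f‖` by the sample against `ψ_j` plus a multiple of `‖L_{w,S_j}^{1/2} f‖`
(`norm_le_sample_add_of_poincare`). The block energies add up to at most `⟨L_w f, f⟩`, because the
interactions between different blocks are nonnegative. Summing in `ℓ²` gives the lower bound; the
upper bound is Cauchy–Schwarz on each block. -/

theorem norm_operatorSqrt_sq {A : H →L[ℂ] H} (hA : A.IsPositive) (f : H) :
    ‖operatorSqrt A f‖ ^ 2 = (⟪A f, f⟫_ℂ).re := by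
  have h0 : 0 ≤ A := (ContinuousLinearMap.nonneg_iff_isPositive A).2 hA
  have hsa : IsSelfAdjoint (operatorSqrt A) := (CFC.sqrt_nonneg A).isSelfAdjoint
  have h1 : ⟪(operatorSqrt A * operatorSqrt A) f, f⟫_ℂ = ⟪operatorSqrt A f, operatorSqrt A f⟫_ℂ :=
    hsa.isSymmetric (operatorSqrt A f) f
  have h2 : operatorSqrt A * operatorSqrt A = A := CFC.sqrt_mul_sqrt_self A h0
  rw [h2] at h1
  rw [h1]
  simpa using (inner_self_eq_norm_sq (𝕜 := ℂ) (operatorSqrt A f)).symm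

/-- The cutoff of index `m + 1` vanishes at distance at least `1 / (m + 1)` from `[0, γ]`. The shift
is needed because the cutoff of index `0` is constantly `1`. -/
theorem mul_closedCutoff_sq_le {γ : ℝ} (hγ : 0 ≤ γ) (m : ℕ) (t : ℝ) :
    t * closedCutoff (Set.Icc 0 γ) (m + 1) t ^ 2 ≤
      (γ + 1 / (m + 1)) * closedCutoff (Set.Icc 0 γ) (m + 1) t ^ 2 := by
  by_cases ht : t ≤ γ + 1 / (m + 1)
  · gcongr
  · have hm : (0 : ℝ) < m + 1 := by positivity
    have hne : (Set.Icc 0 γ).Nonempty := ⟨0, le_refl _, hγ⟩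
    have hd : 1 / (m + 1 : ℝ) ≤ Metric.infDist t (Set.Icc 0 γ) := by
      refine (Metric.le_infDist hne).2 fun {y} hy => ?_
      rw [Real.dist_eq]
      refine le_trans ?_ (le_abs_self _)
      linarith [hy.2]
    have h0 : closedCutoff (Set.Icc 0 γ) (m + 1) t = 0 := by
      refine max_eq_left ?_
      rw [div_le_iff₀' hm] at hd
      push_cast
      linarith
    simp [h0]

/-- The scalar inequality for the cutoffs becomes `P A P ≤ a P²` under the continuous functional
calculus, with `a → γ`. Evaluating at `g` and passing to the strong limit gives the bound at the
projected vector, without using that the limit is idempotent. -/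
theorem re_inner_le_of_mem_range_spectralProjection {A : H →L[ℂ] H} (hA : IsSelfAdjoint A)
    {γ : ℝ} (hγ : 0 ≤ γ) {f : H}
    (hf : f ∈ LinearMap.range (spectralProjection A (Set.Icc 0 γ)).toLinearMap) :
    (⟪A f, f⟫_ℂ).re ≤ γ * ‖f‖ ^ 2 := by
  obtain ⟨g, rfl⟩ := hf
  set K := Set.Icc 0 γ
  have hlim : Tendsto (fun m : ℕ => cfc (closedCutoff K (m + 1)) A g) atTop
      (𝓝 (spectralProjection A K g)) :=
    (tendsto_spectralProjection A K g).comp (tendsto_add_atTop_nat 1)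
  have hl : Tendsto (fun m : ℕ => (⟪A (cfc (closedCutoff K (m + 1)) A g),
      cfc (closedCutoff K (m + 1)) A g⟫_ℂ).re) atTop
      (𝓝 (⟪A (spectralProjection A K g), spectralProjection A K g⟫_ℂ).re) :=
    (Complex.continuous_re.tendsto _).comp
      (((A.continuous.tendsto _).comp hlim).inner hlim)
  have hr : Tendsto (fun m : ℕ => (γ + 1 / ((m : ℝ) + 1)) *
      ‖cfc (closedCutoff K (m + 1)) A g‖ ^ 2) atTop
      (𝓝 ((γ + 0) * ‖spectralProjection A K g‖ ^ 2)) :=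
    (tendsto_const_nhds.add tendsto_one_div_add_atTop_nhds_zero_nat).mul (hlim.norm.pow 2)
  rw [add_zero] at hr
  refine le_of_tendsto_of_tendsto' hl hr fun m => ?_
  set c := closedCutoff K (m + 1) with hc
  have hcc : ContinuousOn c (spectrum ℝ A) := (continuous_closedCutoff K _).continuousOn
  set P := cfc c A with hP
  have hPs : IsSelfAdjoint P := cfc_predicate _ A
  set a : ℝ := γ + 1 / ((m : ℝ) + 1)
  have h1 : cfc (fun t => t * c t ^ 2) A = P * (A * P) := by
    have e : (fun t => t * c t ^ 2) = fun t => c t * (t * c t) := by ext t; ring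
    rw [e, cfc_mul c (fun t => t * c t) A hcc (continuousOn_id.mul hcc),
      cfc_mul (fun t => t) c A continuousOn_id hcc, cfc_id' ℝ A]
  have h2 : cfc (fun t => a * c t ^ 2) A = a • (P * P) := by
    rw [cfc_const_mul a (fun t => c t ^ 2) A (hcc.pow 2), cfc_pow c 2 A hcc, pow_two]
  have h3 : P * (A * P) ≤ a • (P * P) := by
    rw [← h1, ← h2]
    exact cfc_mono (fun t _ => mul_closedCutoff_sq_le hγ m t) (continuousOn_id.mul (hcc.pow 2))
      (continuousOn_const.mul (hcc.pow 2))
  have h4 := ((ContinuousLinearMap.le_def _ _).1 h3).re_inner_nonneg_left g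
  have h5 : ⟪(P * (A * P)) g, g⟫_ℂ = ⟪A (P g), P g⟫_ℂ := hPs.isSymmetric (A (P g)) g
  have h6 : ⟪(P * P) g, g⟫_ℂ = ⟪P g, P g⟫_ℂ := hPs.isSymmetric (P g) g
  have h7 : (⟪P g, P g⟫_ℂ).re = ‖P g‖ ^ 2 := by
    simpa using inner_self_eq_norm_sq (𝕜 := ℂ) (P g)
  have h8 : ⟪(a • (P * P)) g, g⟫_ℂ = a * ⟪P g, P g⟫_ℂ := by
    rw [← h6, smul_apply, ← Complex.coe_smul, inner_smul_left,
      Complex.conj_ofReal]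
  rw [sub_apply, inner_sub_left, h5, h8] at h4
  simp only [map_sub, RCLike.re_to_complex, Complex.re_ofReal_mul, h7] at h4
  linarith

end HilbertSpace

/-- Split `f = c e + g` obliquely, with `g` orthogonal to `ψ` rather than to `e`. Then `c e` is
determined by the sample `⟪ψ, f⟫`, and `g` depends only on the component `h` of `f` orthogonal to
`e`, which the Poincaré inequality bounds. The oblique projection costs a factor `√τ`. In the
application `e` is the constant `1` and `T` is `L_{w,S}^{1/2}`. -/
theorem norm_le_sample_add_of_poincare {H : Type*} [NormedAddCommGroup H]
    [InnerProductSpace ℂ H] (T : H →L[ℂ] H) {e ψ : H} (hψ : ‖ψ‖ = 1)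
    (heψ : ⟪e, ψ⟫_ℂ ≠ 0) (hTe : T e = 0) {δ : ℝ} (hδ : 0 < δ)
    (hT : ∀ h, ⟪e, h⟫_ℂ = 0 → δ * ‖h‖ ≤ ‖T h‖) {θ : ℝ} (hθ : ‖e‖ ^ 2 / ‖⟪e, ψ⟫_ℂ‖ ^ 2 ≤ θ)
    (f : H) :
    ‖f‖ ≤ √θ * ‖⟪ψ, f⟫_ℂ‖ + √θ / δ * ‖T f‖ := by
  have he : e ≠ 0 := by rintro rfl; simp at heψ
  have heψ' : ⟪ψ, e⟫_ℂ ≠ 0 := fun h => heψ (inner_eq_zero_symm.1 h)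
  have hn : 0 < ‖e‖ := norm_pos_iff.2 he
  have hq : 0 < ‖⟪e, ψ⟫_ℂ‖ := norm_pos_iff.2 heψ
  have hee : ⟪e, e⟫_ℂ ≠ 0 := inner_self_ne_zero.2 he
  have heen : ‖⟪e, e⟫_ℂ‖ = ‖e‖ ^ 2 := by
    rw [inner_self_eq_norm_sq_to_K]; simp
  have hsw : ‖⟪ψ, e⟫_ℂ‖ = ‖⟪e, ψ⟫_ℂ‖ := norm_inner_symm _ _
  set τ := ‖e‖ ^ 2 / ‖⟪e, ψ⟫_ℂ‖ ^ 2 with hτ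
  have hτ0 : 0 < τ := by positivity
  have hpyth : ∀ a b : H, ⟪a, b⟫_ℂ = 0 → ‖a + b‖ ^ 2 = ‖a‖ ^ 2 + ‖b‖ ^ 2 := fun a b hab => by
    have := norm_add_sq_eq_norm_sq_add_norm_sq_of_inner_eq_zero a b hab
    simpa [pow_two] using this
  set h := f - (⟪e, f⟫_ℂ / ⟪e, e⟫_ℂ) • e with hh
  have heh : ⟪e, h⟫_ℂ = 0 := by
    rw [hh, inner_sub_right, inner_smul_right, div_mul_cancel₀ _ hee, sub_self]
  have hTh : T h = T f := by rw [hh, map_sub, map_smul, hTe, smul_zero, sub_zero]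
  set φ := ψ - (⟪e, ψ⟫_ℂ / ⟪e, e⟫_ℂ) • e with hφ
  have heφ : ⟪e, φ⟫_ℂ = 0 := by
    rw [hφ, inner_sub_right, inner_smul_right, div_mul_cancel₀ _ hee, sub_self]
  have hφn : ‖φ‖ ^ 2 = 1 - 1 / τ := by
    have h1 := hpyth ((⟪e, ψ⟫_ℂ / ⟪e, e⟫_ℂ) • e) φ (by rw [inner_smul_left, heφ, mul_zero])
    rw [hφ, add_sub_cancel, hψ, ← hφ, norm_smul, norm_div, heen] at h1
    rw [hτ]
    have : (‖⟪e, ψ⟫_ℂ‖ / ‖e‖ ^ 2 * ‖e‖) ^ 2 = 1 / (‖e‖ ^ 2 / ‖⟪e, ψ⟫_ℂ‖ ^ 2) := by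
      field_simp
    rw [this] at h1
    linarith
  have hψh : ⟪ψ, h⟫_ℂ = ⟪φ, h⟫_ℂ := by
    rw [hφ, inner_sub_left, inner_smul_left, heh, mul_zero, sub_zero]
  -- Only the part `φ` of `ψ` orthogonal to `e` pairs with `h`. Cauchy–Schwarz with `φ` in place of
  -- `ψ` is what makes the factor for `g` exactly `√τ` instead of `√(1 + τ)`.
  have hψh' : ‖⟪ψ, h⟫_ℂ‖ ^ 2 ≤ (1 - 1 / τ) * ‖h‖ ^ 2 := by
    rw [hψh, ← hφn, ← mul_pow]
    gcongr
    exact norm_inner_le_norm φ h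
  set g := h - (⟪ψ, h⟫_ℂ / ⟪ψ, e⟫_ℂ) • e with hg
  have hgn : ‖g‖ ≤ √τ * ‖h‖ := by
    have h1 := hpyth h (-((⟪ψ, h⟫_ℂ / ⟪ψ, e⟫_ℂ) • e)) (by
      rw [inner_neg_right, inner_smul_right, inner_eq_zero_symm.1 heh, mul_zero, neg_zero])
    rw [← sub_eq_add_neg, ← hg, norm_neg, norm_smul, norm_div, hsw] at h1
    have h2 : (‖⟪ψ, h⟫_ℂ‖ / ‖⟪e, ψ⟫_ℂ‖ * ‖e‖) ^ 2 = τ * ‖⟪ψ, h⟫_ℂ‖ ^ 2 := by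
      rw [hτ]; field_simp
    have h3 : τ * ‖⟪ψ, h⟫_ℂ‖ ^ 2 ≤ τ * ((1 - 1 / τ) * ‖h‖ ^ 2) := by gcongr
    have h4 : τ * ((1 - 1 / τ) * ‖h‖ ^ 2) = τ * ‖h‖ ^ 2 - ‖h‖ ^ 2 := by field_simp
    refine le_of_sq_le_sq ?_ (by positivity)
    rw [mul_pow, Real.sq_sqrt hτ0.le]
    linarith
  have hfg : f = (⟪ψ, f⟫_ℂ / ⟪ψ, e⟫_ℂ) • e + g := by
    have h1 : ⟪ψ, h⟫_ℂ / ⟪ψ, e⟫_ℂ = ⟪ψ, f⟫_ℂ / ⟪ψ, e⟫_ℂ - ⟪e, f⟫_ℂ / ⟪e, e⟫_ℂ := by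
      rw [hh, inner_sub_right, inner_smul_right]; field_simp
    rw [hg, h1, hh, sub_smul]; abel
  have hc : ‖(⟪ψ, f⟫_ℂ / ⟪ψ, e⟫_ℂ) • e‖ = √τ * ‖⟪ψ, f⟫_ℂ‖ := by
    rw [norm_smul, norm_div, hsw, hτ, Real.sqrt_div (by positivity), Real.sqrt_sq hn.le,
      Real.sqrt_sq hq.le]
    ring
  have hhT : ‖h‖ ≤ ‖T f‖ / δ := by
    rw [le_div_iff₀' hδ, ← hTh]; exact hT h heh
  calc ‖f‖ ≤ ‖(⟪ψ, f⟫_ℂ / ⟪ψ, e⟫_ℂ) • e‖ + ‖g‖ := by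
        conv_lhs => rw [hfg]
        exact norm_add_le _ _
    _ ≤ √τ * ‖⟪ψ, f⟫_ℂ‖ + √τ * (‖T f‖ / δ) := by rw [hc]; gcongr; exact hgn.trans (by gcongr)
    _ ≤ √θ * ‖⟪ψ, f⟫_ℂ‖ + √θ * (‖T f‖ / δ) := by gcongr
    _ = _ := by ring

/-- The sum over the blocks of the local estimates, by Minkowski's inequality. -/
theorem sq_le_sum_sq_of_local_bounds {ι : Type*} [Fintype ι] {n a b : ι → ℝ} {N α β E : ℝ}
    (hn : ∀ j, 0 ≤ n j) (hα : 0 ≤ α) (hβ : 0 ≤ β)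
    (hnab : ∀ j, n j ≤ α * a j + β * b j)
    (hsum : ∑ j, n j ^ 2 = N ^ 2) (hE : ∑ j, b j ^ 2 ≤ E ^ 2) (hE0 : 0 ≤ E)
    (hEN : β * E ≤ N) :
    (N - β * E) ^ 2 ≤ α ^ 2 * ∑ j, a j ^ 2 := by
  set A := √(∑ j, a j ^ 2) with hA
  have hA2 : A ^ 2 = ∑ j, a j ^ 2 := Real.sq_sqrt (Finset.sum_nonneg fun _ _ => sq_nonneg _)
  have hA0 : 0 ≤ A := Real.sqrt_nonneg _
  have hab : ∑ j, a j * b j ≤ A * E := by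
    refine (Real.sum_mul_le_sqrt_mul_sqrt _ _ _).trans ?_
    gcongr
    exact Real.sqrt_le_left hE0 |>.2 hE
  have h1 : N ^ 2 ≤ (α * A + β * E) ^ 2 := by
    calc N ^ 2 = ∑ j, n j ^ 2 := hsum.symm
      _ ≤ ∑ j, (α * a j + β * b j) ^ 2 :=
          Finset.sum_le_sum fun j _ => pow_le_pow_left₀ (hn j) (hnab j) 2
      _ = α ^ 2 * ∑ j, a j ^ 2 + 2 * α * β * ∑ j, a j * b j + β ^ 2 * ∑ j, b j ^ 2 := by
          simp only [Finset.mul_sum, ← Finset.sum_add_distrib]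
          exact Finset.sum_congr rfl fun j _ => by ring
      _ ≤ α ^ 2 * A ^ 2 + 2 * α * β * (A * E) + β ^ 2 * E ^ 2 := by
          rw [hA2]; gcongr
      _ = _ := by ring
  have h2 : N ≤ α * A + β * E := le_of_sq_le_sq h1 (by positivity)
  rw [← hA2, ← mul_pow]
  exact pow_le_pow_left₀ (by linarith) (by linarith) 2

/-- A small perturbation of `γ` costs at most a factor `2` in the frame bound. -/
theorem exists_pos_half_sq_le {δ θ γ : ℝ} (h : √(θ * γ) < δ) :
    ∃ ε > 0, √(θ * (γ + ε)) < δ ∧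
      (δ - √(θ * γ)) ^ 2 / 2 ≤ (δ - √(θ * (γ + ε))) ^ 2 := by
  have hc : Tendsto (fun ε : ℝ => √(θ * (γ + ε))) (𝓝[>] 0) (𝓝 (√(θ * γ))) := by
    have : Continuous fun ε : ℝ => √(θ * (γ + ε)) := by fun_prop
    simpa using (this.tendsto 0).mono_left nhdsWithin_le_nhds
  have hpos : 0 < δ - √(θ * γ) := sub_pos.2 h
  have h2 : (δ - √(θ * γ)) ^ 2 / 2 < (δ - √(θ * γ)) ^ 2 := half_lt_self (by positivity)
  have e1 := hc.eventually (gt_mem_nhds h)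
  have e2 := ((tendsto_const_nhds.sub hc).pow 2).eventually (lt_mem_nhds h2)
  obtain ⟨ε, ⟨h3, h4⟩, h5⟩ := ((e1.and e2).and self_mem_nhdsWithin).exists
  exact ⟨ε, h5, h3, h4.le⟩

/-! ### Dirichlet energies and the cut norm -/

section KernelForm

variable {X : Type*} [MeasurableSpace X] {μ : Measure X}

theorem integrable_kernel_mul {u : X × X → ℝ} (hu : AEMeasurable u (μ.prod μ))
    (hb : ∀ p, |u p| ≤ 1) {F : X × X → ℝ} (hF : Integrable F (μ.prod μ)) :
    Integrable (fun p => u p * F p) (μ.prod μ) :=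
  hF.bdd_mul (c := 1) hu.aestronglyMeasurable (ae_of_all _ hb)

theorem integral_comp_swap [SFinite μ] {E : Type*} [NormedAddCommGroup E] [NormedSpace ℝ E]
    (F : X × X → E) : ∫ p, F p.swap ∂(μ.prod μ) = ∫ p, F p ∂(μ.prod μ) :=
  integral_prod_swap F

/-- Among weights in `[0, 1]` the integral against `F` is largest for the indicator of `{F ≥ 0}`; a
measurable representative of `F` makes this set measurable. If `a * F` is not integrable, the left
side is `0` by convention. -/
theorem exists_setIntegral_ge {F a : X → ℝ} (hF : Integrable F μ)
    (ha : ∀ x, a x ∈ Set.Icc 0 1) :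
    ∃ S, MeasurableSet S ∧ ∫ x, a x * F x ∂μ ≤ ∫ x in S, F x ∂μ := by
  set F' := hF.1.mk F with hF'
  have hm : Measurable F' := hF.1.stronglyMeasurable_mk.measurable
  have hS : MeasurableSet {x | 0 ≤ F' x} := measurableSet_le measurable_const hm
  refine ⟨_, hS, ?_⟩
  rw [← integral_indicator hS]
  by_cases hi : Integrable (fun x => a x * F x) μ
  · refine integral_mono_ae hi (hF.indicator hS) ?_
    filter_upwards [hF.1.ae_eq_mk] with x hx
    by_cases h0 : x ∈ {x | 0 ≤ F' x}
    · rw [Set.indicator_of_mem h0]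
      have : 0 ≤ F x := by rw [hx]; exact h0
      exact mul_le_of_le_one_left this (ha x).2
    · rw [Set.indicator_of_notMem h0]
      have : F x < 0 := by rw [hx]; exact not_le.1 h0
      exact mul_nonpos_of_nonneg_of_nonpos (ha x).1 this.le
  · rw [integral_undef hi]
    refine integral_nonneg_of_ae ?_
    filter_upwards [hF.1.ae_eq_mk] with x hx
    by_cases h0 : x ∈ {x | 0 ≤ F' x}
    · rw [Set.indicator_of_mem h0, hx]; exact h0
    · rw [Set.indicator_of_notMem h0]; rfl

variable [IsFiniteMeasure μ]

theorem integrable_norm_sub_sq {f : X → ℂ} (hf : MemLp f 2 μ) :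
    Integrable (fun p : X × X => ‖f p.1 - f p.2‖ ^ 2) (μ.prod μ) :=
  ((hf.comp_fst μ).sub (hf.comp_snd μ)).integrable_norm_pow two_ne_zero

/-- The quadratic form of the Laplacian is one half of the Dirichlet energy. -/
theorem inner_kernelLaplacian_self {w : X × X → ℝ} (hw : AEMeasurable w (μ.prod μ))
    (hb : ∀ p, w p ∈ Set.Icc 0 1) (hs : ∀ᵐ p ∂(μ.prod μ), w p.swap = w p) (f : Lp ℂ 2 μ) :
    ⟪kernelLaplacian hw hb f, f⟫_ℂ =
      ((1 / 2 * ∫ p, w p * ‖f p.1 - f p.2‖ ^ 2 ∂(μ.prod μ) : ℝ) : ℂ) := by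
  have hf := Lp.memLp f
  set G : X × X → ℂ := fun p => (w p : ℂ) * (f p.1 - f p.2) * starRingEnd ℂ (f p.1) with hG
  have hGi : Integrable G (μ.prod μ) := by
    have h1 : Integrable (fun p : X × X => (f p.1 - f p.2) * starRingEnd ℂ (f p.1))
        (μ.prod μ) :=
      ((hf.comp_fst μ).sub (hf.comp_snd μ)).integrable_mul (hf.comp_fst μ).star
    have h2 := h1.bdd_mul (f := fun p => (w p : ℂ)) (c := 1)
      (Complex.measurable_ofReal.comp_aemeasurable hw).aestronglyMeasurable
      (ae_of_all _ fun p => by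
        rw [Complex.norm_real, Real.norm_eq_abs, abs_of_nonneg (hb p).1]
        exact (hb p).2)
    exact h2.congr (ae_of_all _ fun p => by simp only [hG]; ring)
  have hGs : Integrable (fun p => G p.swap) (μ.prod μ) := hGi.swap
  have h1 : ⟪f, kernelLaplacian hw hb f⟫_ℂ = ∫ p, G p ∂(μ.prod μ) := by
    rw [L2.inner_def, integral_prod _ hGi]
    refine integral_congr_ae ?_
    filter_upwards [kernelLaplacian_ae_eq hw hb f] with x hx
    rw [RCLike.inner_apply, hx, ← integral_mul_const]
  -- Symmetrization: exchanging `x` and `y` in one copy turns the sum of the integrands into `w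
  -- |f(x) - f(y)|²`.
  have h2 : (∫ p, G p ∂(μ.prod μ)) + ∫ p, G p ∂(μ.prod μ) =
      ((∫ p, w p * ‖f p.1 - f p.2‖ ^ 2 ∂(μ.prod μ) : ℝ) : ℂ) := by
    conv_lhs => rw [← integral_comp_swap (μ := μ) G]
    conv_lhs => enter [2]; rw [integral_comp_swap (μ := μ) G]
    rw [← integral_add hGs hGi, ← integral_complex_ofReal]
    refine integral_congr_ae ?_
    filter_upwards [hs] with p hp
    simp only [hG, hp, Prod.fst_swap, Prod.snd_swap]
    push_cast
    rw [← Complex.conj_mul', map_sub]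
    ring
  have h3 : ⟪f, kernelLaplacian hw hb f⟫_ℂ =
      ((1 / 2 * ∫ p, w p * ‖f p.1 - f p.2‖ ^ 2 ∂(μ.prod μ) : ℝ) : ℂ) := by
    rw [h1, Complex.ofReal_mul, ← h2]
    push_cast
    ring
  rw [← inner_conj_symm, h3, Complex.conj_ofReal]

theorem kernelLaplacian_isPositive {w : X × X → ℝ} (hw : AEMeasurable w (μ.prod μ))
    (hb : ∀ p, w p ∈ Set.Icc 0 1) (hs : ∀ᵐ p ∂(μ.prod μ), w p.swap = w p) :
    (kernelLaplacian hw hb).IsPositive := by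
  rw [ContinuousLinearMap.isPositive_iff_complex]
  intro f
  rw [inner_kernelLaplacian_self hw hb hs]
  refine ⟨by simp, ?_⟩
  rw [RCLike.re_to_complex, Complex.ofReal_re]
  exact mul_nonneg (by norm_num)
    (integral_nonneg fun p => mul_nonneg (hb p).1 (sq_nonneg _))

/-- The form is linear in each weight separately, so by Fubini `a` can be replaced by the indicator
of a set `S`, and then `b` by that of a set `T`, without decreasing the integral. -/
theorem integral_kernel_mul_le {u : X × X → ℝ} (hu : AEMeasurable u (μ.prod μ))
    (hb : ∀ p, |u p| ≤ 1) {c : ℝ} (hc : ∀ S T : Set X, MeasurableSet S → MeasurableSet T →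
      ∫ p in S ×ˢ T, u p ∂(μ.prod μ) ≤ c)
    {a b : X → ℝ} (ham : AEMeasurable a μ) (hbm : AEMeasurable b μ)
    (ha : ∀ x, a x ∈ Set.Icc 0 1) (hb1 : ∀ x, b x ∈ Set.Icc 0 1) :
    ∫ p, u p * (a p.1 * b p.2) ∂(μ.prod μ) ≤ c := by
  have hn : ∀ {t : ℝ}, t ∈ Set.Icc (0 : ℝ) 1 → ‖t‖ ≤ 1 := fun h => by
    rw [Real.norm_eq_abs, abs_of_nonneg h.1]; exact h.2
  have ui : Integrable u (μ.prod μ) :=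
    Integrable.of_bound hu.aestronglyMeasurable 1 (ae_of_all _ hb)
  have hbi : Integrable (fun p : X × X => b p.2 * u p) (μ.prod μ) :=
    ui.bdd_mul (c := 1) hbm.aestronglyMeasurable.comp_snd (ae_of_all _ fun p => hn (hb1 _))
  have habi : Integrable (fun p : X × X => a p.1 * (b p.2 * u p)) (μ.prod μ) :=
    hbi.bdd_mul (c := 1) ham.aestronglyMeasurable.comp_fst (ae_of_all _ fun p => hn (ha _))
  obtain ⟨S, hS, hSle⟩ := exists_setIntegral_ge hbi.integral_prod_left ha
  have hbiS : Integrable (fun p : X × X => b p.2 * u p) ((μ.restrict S).prod μ) := by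
    have := hbi.restrict (s := S ×ˢ Set.univ)
    rwa [← Measure.prod_restrict, Measure.restrict_univ] at this
  have uiS : Integrable u ((μ.restrict S).prod μ) := by
    have := ui.restrict (s := S ×ˢ Set.univ)
    rwa [← Measure.prod_restrict, Measure.restrict_univ] at this
  obtain ⟨T, hT, hTle⟩ := exists_setIntegral_ge uiS.integral_prod_right hb1
  have uiST : Integrable u ((μ.restrict S).prod (μ.restrict T)) := by
    rw [Measure.prod_restrict]; exact ui.restrict
  calc ∫ p, u p * (a p.1 * b p.2) ∂(μ.prod μ)
      = ∫ p, a p.1 * (b p.2 * u p) ∂(μ.prod μ) := integral_congr_ae (ae_of_all _ fun p => by ring)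
    _ = ∫ x, a x * ∫ y, b y * u (x, y) ∂μ ∂μ := by
        rw [integral_prod _ habi]; simp only [integral_const_mul]
    _ ≤ ∫ x in S, ∫ y, b y * u (x, y) ∂μ ∂μ := hSle
    _ = ∫ y, b y * ∫ x in S, u (x, y) ∂μ ∂μ := by
        rw [← integral_prod _ hbiS, integral_prod_symm _ hbiS]; simp only [integral_const_mul]
    _ ≤ ∫ y in T, ∫ x in S, u (x, y) ∂μ ∂μ := hTle
    _ = ∫ p in S ×ˢ T, u p ∂(μ.prod μ) := by
        rw [← integral_prod_symm _ uiST, Measure.prod_restrict]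
    _ ≤ c := hc S T hS hT

theorem abs_integral_kernel_mul_le {u : X × X → ℝ} (hu : AEMeasurable u (μ.prod μ))
    (hb : ∀ p, |u p| ≤ 1) {c : ℝ} (hc : ∀ S T : Set X, MeasurableSet S → MeasurableSet T →
      |∫ p in S ×ˢ T, u p ∂(μ.prod μ)| ≤ c) {M : ℝ} (hM : 0 < M)
    {a b : X → ℝ} (ham : AEMeasurable a μ) (hbm : AEMeasurable b μ)
    (ha : ∀ x, a x ∈ Set.Icc 0 M) (hb1 : ∀ x, b x ∈ Set.Icc 0 M) :
    |∫ p, u p * (a p.1 * b p.2) ∂(μ.prod μ)| ≤ M ^ 2 * c := by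
  have hd : ∀ {t : ℝ}, t ∈ Set.Icc (0 : ℝ) M → t / M ∈ Set.Icc (0 : ℝ) 1 := fun h =>
    ⟨div_nonneg h.1 hM.le, (div_le_one hM).2 h.2⟩
  have h1 := integral_kernel_mul_le hu hb (fun S T hS hT => (abs_le.1 (hc S T hS hT)).2)
    (ham.div_const M) (hbm.div_const M) (fun x => hd (ha x)) (fun x => hd (hb1 x))
  have h2 := integral_kernel_mul_le (u := fun p => -u p) hu.neg (fun p => by rw [abs_neg]; exact hb p)
    (fun S T hS hT => by rw [integral_neg]; linarith [(abs_le.1 (hc S T hS hT)).1])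
    (ham.div_const M) (hbm.div_const M) (fun x => hd (ha x)) (fun x => hd (hb1 x))
  have e : ∫ p, u p * (a p.1 * b p.2) ∂(μ.prod μ) =
      M ^ 2 * ∫ p, u p * (a p.1 / M * (b p.2 / M)) ∂(μ.prod μ) := by
    rw [← integral_const_mul]
    exact integral_congr_ae (ae_of_all _ fun p => by field_simp)
  simp only [neg_mul, integral_neg] at h2
  rw [e, abs_mul, abs_of_nonneg (sq_nonneg M)]
  gcongr
  exact abs_le.2 ⟨by linarith, h1⟩

theorem integral_abs_le_of_integral_sq_le {ν : Measure X} [IsProbabilityMeasure ν] {q : X → ℝ}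
    (hq : MemLp q 2 ν) {N : ℝ} (hN : 0 < N) (hqN : ∫ x, q x ^ 2 ∂ν ≤ N ^ 2) :
    ∫ x, |q x| ∂ν ≤ N := by
  have h1 : ∫ x, |q x| ∂ν ≤ ∫ x, (q x ^ 2 / (2 * N) + N / 2) ∂ν := by
    -- Pointwise `|q| ≤ q² / (2N) + N / 2`, from `(|q| - N)² ≥ 0`; total mass one then gives `N / 2
    -- + N / 2`.
    refine integral_mono (hq.integrable one_le_two).abs
      ((hq.integrable_sq.div_const _).add (integrable_const _)) fun x => ?_
    have h : q x ^ 2 / (2 * N) + N / 2 - |q x| = (|q x| - N) ^ 2 / (2 * N) := by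
      rw [← sq_abs]; field_simp; ring
    have : 0 ≤ (|q x| - N) ^ 2 / (2 * N) := by positivity
    show |q x| ≤ q x ^ 2 / (2 * N) + N / 2
    linarith
  rw [integral_add (hq.integrable_sq.div_const _) (integrable_const _), integral_div] at h1
  simp only [integral_const, probReal_univ, one_smul] at h1
  have h2 : (∫ x, q x ^ 2 ∂ν) / (2 * N) ≤ N ^ 2 / (2 * N) := by gcongr
  have h3 : N ^ 2 / (2 * N) = N / 2 := by field_simp
  linarith

/-- Truncation at height `M`: the part above `M` has `L¹` norm at most `M⁻¹` times the squared
`L²` norm. -/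
theorem abs_sub_truncation_le {M : ℝ} (hM : 0 < M) (t : ℝ) :
    |t - (min (max t 0) M - min (max (-t) 0) M)| ≤ t ^ 2 / M ∧
      |min (max t 0) M - min (max (-t) 0) M| ≤ |t| := by
  have key : ∀ s : ℝ, 0 ≤ s → |s - min s M| ≤ s ^ 2 / M ∧ |min s M| ≤ s := fun s hs => by
    rcases le_total s M with h | h
    · rw [min_eq_left h, sub_self, abs_zero]
      exact ⟨by positivity, (abs_of_nonneg hs).le⟩
    · rw [min_eq_right h, abs_of_nonneg (sub_nonneg.2 h), abs_of_pos hM]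
      refine ⟨?_, h⟩
      rw [le_div_iff₀ hM]
      nlinarith
  rcases le_total 0 t with h | h
  · have h1 := key t h
    rw [max_eq_left h, max_eq_right (neg_nonpos.2 h), min_eq_left hM.le, sub_zero,
      abs_of_nonneg h]
    exact h1
  · have h1 := key (-t) (neg_nonneg.2 h)
    rw [max_eq_right h, max_eq_left (neg_nonneg.2 h), min_eq_left hM.le, zero_sub, abs_neg,
      abs_of_nonpos h, ← abs_neg, show -(t - -min (-t) M) = -t - min (-t) M by ring]
    rw [neg_sq] at h1
    exact h1

/-- The bilinear form of a bounded kernel on `L²` is controlled by the cut norm. -/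
theorem abs_integral_kernel_quadratic_le {ν : Measure X} [IsProbabilityMeasure ν]
    {u : X × X → ℝ} (hu : AEMeasurable u (ν.prod ν))
    (hb : ∀ p, |u p| ≤ 1) {c : ℝ} (hc : ∀ S T : Set X, MeasurableSet S → MeasurableSet T →
      |∫ p in S ×ˢ T, u p ∂(ν.prod ν)| ≤ c) {q : X → ℝ} (hq : MemLp q 2 ν)
    {N : ℝ} (hN : 0 < N) (hqN : ∫ x, q x ^ 2 ∂ν ≤ N ^ 2) {K : ℝ} (hK : 0 < K) :
    |∫ p, u p * (q p.1 * q p.2) ∂(ν.prod ν)| ≤ (4 * K ^ 2 * c + 2 / K) * N ^ 2 := by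
  -- The truncation height is proportional to the `L²` bound `N`, so that both error terms scale
  -- like `N²`. The free parameter `K` trades the cut norm term `4 K² c` against the tail `2 / K`.
  set M := K * N with hMdef
  have hM : 0 < M := mul_pos hK hN
  have hqm : AEMeasurable q ν := hq.1.aemeasurable
  have hqi : Integrable q ν := hq.integrable one_le_two
  set a : X → ℝ := fun x => min (max (q x) 0) M with ha
  set b : X → ℝ := fun x => min (max (-q x) 0) M with hbdef
  have ham : AEMeasurable a ν := (hqm.max aemeasurable_const).min aemeasurable_const
  have hbm : AEMeasurable b ν := (hqm.neg.max aemeasurable_const).min aemeasurable_const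
  have haM : ∀ x, a x ∈ Set.Icc 0 M := fun x =>
    ⟨le_min (le_max_right _ _) hM.le, min_le_right _ _⟩
  have hbM : ∀ x, b x ∈ Set.Icc 0 M := fun x =>
    ⟨le_min (le_max_right _ _) hM.le, min_le_right _ _⟩
  have hI : ∀ {s t : X → ℝ}, AEMeasurable s ν → AEMeasurable t ν → (∀ x, s x ∈ Set.Icc 0 M) →
      (∀ x, t x ∈ Set.Icc 0 M) → Integrable (fun p : X × X => u p * (s p.1 * t p.2))
      (ν.prod ν) := fun {s t} hs ht hs1 ht1 => by
    have h0 : ∀ {t : ℝ}, t ∈ Set.Icc (0 : ℝ) M → ‖t‖ ≤ M := fun h => by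
      rw [Real.norm_eq_abs, abs_of_nonneg h.1]; exact h.2
    exact integrable_kernel_mul hu hb
      ((Integrable.of_bound hs.aestronglyMeasurable M (ae_of_all _ fun x => h0 (hs1 x))).mul_prod
        (Integrable.of_bound ht.aestronglyMeasurable M (ae_of_all _ fun x => h0 (ht1 x))))
  have haa := abs_integral_kernel_mul_le hu hb hc hM ham ham haM haM
  have hab := abs_integral_kernel_mul_le hu hb hc hM ham hbm haM hbM
  have hba := abs_integral_kernel_mul_le hu hb hc hM hbm ham hbM haM
  have hbb := abs_integral_kernel_mul_le hu hb hc hM hbm hbm hbM hbM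
  have hIt : Integrable (fun p : X × X => u p * ((a p.1 - b p.1) * (a p.2 - b p.2)))
      (ν.prod ν) :=
    ((((hI ham ham haM haM).sub (hI ham hbm haM hbM)).sub (hI hbm ham hbM haM)).add
      (hI hbm hbm hbM hbM)).congr (ae_of_all _ fun p => by
        simp only [Pi.add_apply, Pi.sub_apply]; ring)
  -- The truncated function is `a - b`, with `a` and `b` the truncated positive and negative parts;
  -- each of the four products contributes at most `M² c`.
  have htrunc : |∫ p, u p * ((a p.1 - b p.1) * (a p.2 - b p.2)) ∂(ν.prod ν)| ≤
      4 * (M ^ 2 * c) := by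
    have e : ∫ p, u p * ((a p.1 - b p.1) * (a p.2 - b p.2)) ∂(ν.prod ν) =
        ∫ p, u p * (a p.1 * a p.2) ∂(ν.prod ν) - ∫ p, u p * (a p.1 * b p.2) ∂(ν.prod ν) -
        ∫ p, u p * (b p.1 * a p.2) ∂(ν.prod ν) + ∫ p, u p * (b p.1 * b p.2) ∂(ν.prod ν) := by
      have j1 : Integrable (fun p : X × X => u p * (a p.1 * a p.2) - u p * (a p.1 * b p.2))
          (ν.prod ν) := (hI ham ham haM haM).sub (hI ham hbm haM hbM)
      have j2 : Integrable (fun p : X × X => u p * (a p.1 * a p.2) - u p * (a p.1 * b p.2) -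
          u p * (b p.1 * a p.2)) (ν.prod ν) := j1.sub (hI hbm ham hbM haM)
      rw [← integral_sub (hI ham ham haM haM) (hI ham hbm haM hbM),
        ← integral_sub j1 (hI hbm ham hbM haM), ← integral_add j2 (hI hbm hbm hbM hbM)]
      exact integral_congr_ae (ae_of_all _ fun p => by ring)
    rw [e, abs_le]
    rw [abs_le] at haa hab hba hbb
    constructor <;> linarith
  have hIq : Integrable (fun p : X × X => u p * (q p.1 * q p.2)) (ν.prod ν) :=
    integrable_kernel_mul hu hb (hqi.mul_prod hqi)
  have hsq : Integrable (fun x => q x ^ 2 / M) ν := hq.integrable_sq.div_const M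
  -- With `t = a - b`, write `q(x)q(y) - t(x)t(y) = (q - t)(x) q(y) + t(x) (q - t)(y)`. Each term
  -- has `L¹` norm at most `(N² / M) · N = N² / K`.
  have hrest : |∫ p, u p * (q p.1 * q p.2) ∂(ν.prod ν) -
      ∫ p, u p * ((a p.1 - b p.1) * (a p.2 - b p.2)) ∂(ν.prod ν)| ≤ 2 / K * N ^ 2 := by
    rw [← integral_sub hIq hIt]
    have hB : Integrable (fun p : X × X => q p.1 ^ 2 / M * |q p.2| + |q p.1| * (q p.2 ^ 2 / M))
        (ν.prod ν) := (hsq.mul_prod hqi.abs).add (hqi.abs.mul_prod hsq)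
    have h1 := norm_integral_le_of_norm_le
      (f := fun p : X × X => u p * (q p.1 * q p.2) - u p * ((a p.1 - b p.1) * (a p.2 - b p.2)))
      hB (ae_of_all _ fun p => by
        have hx := abs_sub_truncation_le hM (q p.1)
        have hy := abs_sub_truncation_le hM (q p.2)
        have e : u p * (q p.1 * q p.2) - u p * ((a p.1 - b p.1) * (a p.2 - b p.2)) =
            u p * ((q p.1 - (a p.1 - b p.1)) * q p.2 +
              (a p.1 - b p.1) * (q p.2 - (a p.2 - b p.2))) := by ring
        rw [e, norm_mul]
        refine (mul_le_of_le_one_left (norm_nonneg _) (hb p)).trans ((norm_add_le _ _).trans ?_)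
        rw [norm_mul, norm_mul]
        simp only [Real.norm_eq_abs]
        exact add_le_add (mul_le_mul_of_nonneg_right hx.1 (abs_nonneg _))
          (mul_le_mul hx.2 hy.1 (abs_nonneg _) (abs_nonneg _)))
    rw [Real.norm_eq_abs] at h1
    refine h1.trans ?_
    rw [integral_add (hsq.mul_prod hqi.abs) (hqi.abs.mul_prod hsq),
      integral_prod_mul (fun x => q x ^ 2 / M) (fun x => |q x|),
      integral_prod_mul (fun x => |q x|) (fun x => q x ^ 2 / M), integral_div]
    have h2 := integral_abs_le_of_integral_sq_le hq hN hqN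
    have h3 : 0 ≤ ∫ x, |q x| ∂ν := integral_nonneg fun _ => abs_nonneg _
    have h4 : (∫ x, q x ^ 2 ∂ν) / M ≤ N ^ 2 / M := by gcongr
    have h5 : (∫ x, q x ^ 2 ∂ν) / M * ∫ x, |q x| ∂ν ≤ N ^ 2 / M * N :=
      mul_le_mul h4 h2 h3 (by positivity)
    have h6 : N ^ 2 / M * N = N ^ 2 / K := by rw [hMdef]; field_simp
    have h7 : 2 / K * N ^ 2 = N ^ 2 / K + N ^ 2 / K := by ring
    rw [h7, mul_comm (∫ x, |q x| ∂ν)]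
    linarith
  have e : (4 * K ^ 2 * c + 2 / K) * N ^ 2 = 4 * (M ^ 2 * c) + 2 / K * N ^ 2 := by
    rw [hMdef]; ring
  rw [e]
  rw [abs_le] at htrunc hrest ⊢
  constructor <;> linarith

/-- Lower bound for the Dirichlet energy of a signed kernel with small degree function and small
cut norm. -/
theorem neg_le_integral_kernel_energy {ν : Measure X} [IsProbabilityMeasure ν]
    {u : X × X → ℝ} (hu : AEMeasurable u (ν.prod ν))
    (hb : ∀ p, |u p| ≤ 1) (hs : ∀ᵐ p ∂(ν.prod ν), u p.swap = u p) {c η : ℝ}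
    (hc : ∀ S T : Set X, MeasurableSet S → MeasurableSet T →
      |∫ p in S ×ˢ T, u p ∂(ν.prod ν)| ≤ c)
    (hη : ∀ᵐ x ∂ν, |∫ y, u (x, y) ∂ν| ≤ η) {f : X → ℂ} (hf : MemLp f 2 ν)
    {N : ℝ} (hN : 0 < N) (hfN : ∫ x, ‖f x‖ ^ 2 ∂ν = N ^ 2) {K : ℝ} (hK : 0 < K) :
    -(2 * η + 4 * (4 * K ^ 2 * c + 2 / K)) * N ^ 2 ≤
      ∫ p, u p * ‖f p.1 - f p.2‖ ^ 2 ∂(ν.prod ν) := by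
  have hf2 : Integrable (fun x => ‖f x‖ ^ 2) ν := hf.integrable_norm_pow two_ne_zero
  have hre : MemLp (fun x => (f x).re) 2 ν := hf.re
  have him : MemLp (fun x => (f x).im) 2 ν := hf.im
  have hns : ∀ z : ℂ, ‖z‖ ^ 2 = z.re ^ 2 + z.im ^ 2 := fun z => by
    rw [← Complex.normSq_eq_norm_sq, Complex.normSq_apply]; ring
  have hreN : ∫ x, (f x).re ^ 2 ∂ν ≤ N ^ 2 := by
    rw [← hfN]
    exact integral_mono hre.integrable_sq hf2 fun x => by
      show (f x).re ^ 2 ≤ ‖f x‖ ^ 2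
      rw [hns]; linarith [sq_nonneg (f x).im]
  have himN : ∫ x, (f x).im ^ 2 ∂ν ≤ N ^ 2 := by
    rw [← hfN]
    exact integral_mono him.integrable_sq hf2 fun x => by
      show (f x).im ^ 2 ≤ ‖f x‖ ^ 2
      rw [hns]; linarith [sq_nonneg (f x).re]
  have h1 := abs_integral_kernel_quadratic_le hu hb hc hre hN hreN hK
  have h2 := abs_integral_kernel_quadratic_le hu hb hc him hN himN hK
  have i1 : Integrable (fun p : X × X => u p * ((f p.1).re * (f p.2).re)) (ν.prod ν) :=
    integrable_kernel_mul hu hb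
      ((hre.integrable one_le_two).mul_prod (hre.integrable one_le_two))
  have i2 : Integrable (fun p : X × X => u p * ((f p.1).im * (f p.2).im)) (ν.prod ν) :=
    integrable_kernel_mul hu hb
      ((him.integrable one_le_two).mul_prod (him.integrable one_le_two))
  have i3 : Integrable (fun p : X × X => u p * ‖f p.1‖ ^ 2) (ν.prod ν) :=
    integrable_kernel_mul hu hb (hf2.comp_fst ν)
  have i4 : Integrable (fun p : X × X => u p * ‖f p.2‖ ^ 2) (ν.prod ν) :=
    integrable_kernel_mul hu hb (hf2.comp_snd ν)
  have h3 : ∫ p, u p * ‖f p.2‖ ^ 2 ∂(ν.prod ν) = ∫ p, u p * ‖f p.1‖ ^ 2 ∂(ν.prod ν) := by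
    rw [← integral_comp_swap]
    refine integral_congr_ae ?_
    filter_upwards [hs] with p hp
    simp [hp]
  -- Integrating out `y` first leaves the degree of `u` times `|f(x)|²`.
  have h4 : -(η * N ^ 2) ≤ ∫ p, u p * ‖f p.1‖ ^ 2 ∂(ν.prod ν) := by
    rw [integral_prod _ i3, ← hfN, ← integral_const_mul, ← integral_neg]
    refine integral_mono_ae (hf2.const_mul η).neg i3.integral_prod_left ?_
    filter_upwards [hη] with x hx
    show -(η * ‖f x‖ ^ 2) ≤ ∫ y, u (x, y) * ‖f x‖ ^ 2 ∂ν
    rw [integral_mul_const, ← neg_mul]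
    exact mul_le_mul_of_nonneg_right (abs_le.1 hx).1 (sq_nonneg _)
  -- The cross term `2 Re (f(x) conj f(y))` splits into real bilinear forms in `Re f` and `Im f`.
  -- Two forms with coefficient 2 account for the factor 4 in the bound, and the two diagonal terms
  -- for `2 η`.
  have e : ∫ p, u p * ‖f p.1 - f p.2‖ ^ 2 ∂(ν.prod ν) =
      ∫ p, u p * ‖f p.1‖ ^ 2 ∂(ν.prod ν) + ∫ p, u p * ‖f p.2‖ ^ 2 ∂(ν.prod ν) -
      2 * (∫ p, u p * ((f p.1).re * (f p.2).re) ∂(ν.prod ν) +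
        ∫ p, u p * ((f p.1).im * (f p.2).im) ∂(ν.prod ν)) := by
    have j1 : Integrable (fun p : X × X => u p * ‖f p.1‖ ^ 2 + u p * ‖f p.2‖ ^ 2)
        (ν.prod ν) := i3.add i4
    have j2 : Integrable (fun p : X × X => 2 * (u p * ((f p.1).re * (f p.2).re) +
        u p * ((f p.1).im * (f p.2).im))) (ν.prod ν) := (i1.add i2).const_mul 2
    rw [← integral_add i1 i2, ← integral_const_mul, ← integral_add i3 i4, ← integral_sub j1 j2]
    refine integral_congr_ae (ae_of_all _ fun p => ?_)
    simp only [hns, Complex.sub_re, Complex.sub_im]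
    ring
  rw [e, h3]
  rw [abs_le] at h1 h2
  linarith

end KernelForm

/-! ### Norms, inner products and constants in `L²` -/

section SquareIntegrable

variable {X : Type*} [MeasurableSpace X] {μ : Measure X}

theorem sq_norm_eq_integral (f : Lp ℂ 2 μ) : ‖f‖ ^ 2 = ∫ x, ‖f x‖ ^ 2 ∂μ := by
  have h1 : ((‖f‖ : ℂ)) ^ 2 = ∫ x, ⟪f x, f x⟫_ℂ ∂μ := by
    rw [← L2.inner_def]; exact (inner_self_eq_norm_sq_to_K f).symm
  have h2 : ∫ x, ⟪f x, f x⟫_ℂ ∂μ = ((∫ x, ‖f x‖ ^ 2 ∂μ : ℝ) : ℂ) := by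
    rw [← integral_complex_ofReal]
    refine integral_congr_ae (ae_of_all _ fun x => ?_)
    show ⟪f x, f x⟫_ℂ = _
    rw [inner_self_eq_norm_sq_to_K]; simp
  rw [h2] at h1
  exact_mod_cast h1

variable [IsFiniteMeasure μ]

theorem inner_const_one (f : Lp ℂ 2 μ) :
    ⟪(Lp.const 2 μ (1 : ℂ) : Lp ℂ 2 μ), f⟫_ℂ = ∫ x, f x ∂μ := by
  rw [L2.inner_def]
  refine integral_congr_ae ?_
  filter_upwards [Lp.coeFn_const 2 μ (1 : ℂ)] with x hx
  rw [hx]; simp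

theorem sq_norm_const_one : ‖(Lp.const 2 μ (1 : ℂ) : Lp ℂ 2 μ)‖ ^ 2 = μ.real Set.univ := by
  rw [sq_norm_eq_integral]
  have : ∫ x, ‖(Lp.const 2 μ (1 : ℂ) : Lp ℂ 2 μ) x‖ ^ 2 ∂μ = ∫ _, (1 : ℝ) ∂μ := by
    refine integral_congr_ae ?_
    filter_upwards [Lp.coeFn_const 2 μ (1 : ℂ)] with x hx
    rw [hx]; simp
  rw [this]; simp

theorem kernelLaplacian_const_one {w : X × X → ℝ} (hw : AEMeasurable w (μ.prod μ))
    (hb : ∀ p, w p ∈ Set.Icc 0 1) :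
    kernelLaplacian hw hb (Lp.const 2 μ (1 : ℂ)) = 0 := by
  refine Lp.ext ?_
  have h1 := Lp.coeFn_const 2 μ (1 : ℂ)
  filter_upwards [kernelLaplacian_ae_eq hw hb (Lp.const 2 μ (1 : ℂ)), h1,
    Lp.coeFn_zero ℂ 2 μ] with x hx hx1 hx0
  rw [hx, hx0, hx1]
  refine integral_eq_zero_of_ae ?_
  filter_upwards [h1] with y hy
  rw [hy]; simp

end SquareIntegrable

/-! ### Decomposing `L²[0,1]` along a partition -/

theorem sum_setIntegral_eq_integral {X ι : Type*} [MeasurableSpace X] {μ : Measure X} [Fintype ι]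
    {S : ι → Set X} (hS : ∀ j, NullMeasurableSet (S j) μ)
    (hd : Pairwise fun i j => Disjoint (S i) (S j)) (hU : ⋃ j, S j = Set.univ)
    {h : X → ℝ} (hh : Integrable h μ) : ∑ j, ∫ x in S j, h x ∂μ = ∫ x, h x ∂μ := by
  rw [← tsum_fintype (L := .unconditional _),
    ← integral_iUnion_ae hS (hd.mono fun _ _ h => h.aedisjoint) hh.integrableOn, hU,
    setIntegral_univ]

/-- The restriction of `f ∈ L²[0,1]` to `L²(S)`. -/
def restrictLp (S : Set I) (f : Lp ℂ 2 (volume : Measure I)) : Lp ℂ 2 (volume.restrict S) :=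
  ((Lp.memLp f).restrict S).toLp f

theorem restrictLp_ae_eq (S : Set I) (f : Lp ℂ 2 (volume : Measure I)) :
    restrictLp S f =ᵐ[volume.restrict S] f := MemLp.coeFn_toLp _

theorem sq_norm_restrictLp (S : Set I) (f : Lp ℂ 2 (volume : Measure I)) :
    ‖restrictLp S f‖ ^ 2 = ∫ x in S, ‖f x‖ ^ 2 := by
  rw [sq_norm_eq_integral]
  refine integral_congr_ae ?_
  filter_upwards [restrictLp_ae_eq S f] with x hx
  rw [hx]

theorem sample_eq_inner (S : Set I) (f : Lp ℂ 2 (volume : Measure I))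
    (ψ : Lp ℂ 2 (volume.restrict S)) : sample S f ψ = ⟪ψ, restrictLp S f⟫_ℂ := by
  rw [L2.inner_def, sample]
  refine integral_congr_ae ?_
  filter_upwards [restrictLp_ae_eq S f] with x hx
  rw [hx, RCLike.inner_apply]

theorem sum_sq_norm_restrictLp {ι : Type*} [Fintype ι] {S : ι → Set I}
    (hS : ∀ j, NullMeasurableSet (S j) volume)
    (hd : Pairwise fun i j => Disjoint (S i) (S j)) (hU : ⋃ j, S j = Set.univ)
    (f : Lp ℂ 2 (volume : Measure I)) : ∑ j, ‖restrictLp (S j) f‖ ^ 2 = ‖f‖ ^ 2 := by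
  simp only [sq_norm_restrictLp]
  rw [sum_setIntegral_eq_integral hS hd hU ((Lp.memLp f).integrable_norm_pow two_ne_zero),
    sq_norm_eq_integral]

/-! ### Laplacians of graphons: comparison of forms and sampling -/

namespace Graphon

theorem laplacian_isPositive (w : Graphon) : w.laplacian.IsPositive :=
  kernelLaplacian_isPositive _ _ w.symm

theorem laplacianOn_symm (w : Graphon) (S : Set I) :
    ∀ᵐ p ∂((volume.restrict S).prod (volume.restrict S)), w.toFun p.swap = w.toFun p := by
  rw [Measure.prod_restrict]
  exact ae_restrict_of_ae w.symm

theorem laplacianOn_isPositive (w : Graphon) (S : Set I) : (w.laplacianOn S).IsPositive :=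
  kernelLaplacian_isPositive _ _ (w.laplacianOn_symm S)

theorem re_inner_laplacian (w : Graphon) (f : Lp ℂ 2 (volume : Measure I)) :
    (⟪w.laplacian f, f⟫_ℂ).re =
      1 / 2 * ∫ p, w.toFun p * ‖f p.1 - f p.2‖ ^ 2 ∂(volume.prod volume) := by
  rw [laplacian, inner_kernelLaplacian_self _ _ w.symm, Complex.ofReal_re]

theorem abs_toFun_le (w : Graphon) (p : I × I) : |w.toFun p| ≤ 1 := by
  rw [abs_of_nonneg (w.mem_Icc p).1]; exact (w.mem_Icc p).2

theorem abs_sub_le (w v : Graphon) (p : I × I) : |v.toFun p - w.toFun p| ≤ 1 := by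
  have h1 := w.mem_Icc p
  have h2 := v.mem_Icc p
  rw [abs_le]
  constructor <;> linarith [h1.1, h1.2, h2.1, h2.2]

theorem integrable_toFun (w : Graphon) : Integrable w.toFun (volume.prod volume) :=
  Integrable.of_bound w.aemeasurable.aestronglyMeasurable 1 (ae_of_all _ w.abs_toFun_le)

theorem abs_setIntegral_le_cutNorm (w v : Graphon) {S T : Set I} (hS : MeasurableSet S)
    (hT : MeasurableSet T) :
    |∫ p in S ×ˢ T, (v.toFun p - w.toFun p) ∂(volume.prod volume)| ≤
      cutNorm (fun p => v.toFun p - w.toFun p) := by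
  refine le_csSup ⟨1, ?_⟩ ⟨S, T, hS, hT, rfl⟩
  rintro _ ⟨S, T, -, -, rfl⟩
  have h := norm_setIntegral_le_of_norm_le_const (μ := (volume : Measure (I × I))) (s := S ×ˢ T)
    (f := fun p => v.toFun p - w.toFun p) (C := 1) (measure_lt_top _ _)
    (fun p _ => w.abs_sub_le v p)
  rw [one_mul] at h
  exact h.trans measureReal_le_one

/-- Cut norm and uniform degree closeness control the quadratic forms of the Laplacians. -/
theorem re_inner_laplacian_le_add (w v : Graphon) {c η K : ℝ} (hK : 0 < K)
    (hc : cutNorm (fun p => v.toFun p - w.toFun p) ≤ c)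
    (hη : ∀ᵐ x, |v.degree x - w.degree x| ≤ η) (f : Lp ℂ 2 (volume : Measure I)) :
    (⟪w.laplacian f, f⟫_ℂ).re ≤
      (⟪v.laplacian f, f⟫_ℂ).re + (η + 2 * (4 * K ^ 2 * c + 2 / K)) * ‖f‖ ^ 2 := by
  -- The energy estimate is applied with `N = ‖f‖`, which must be positive.
  rcases eq_or_ne f 0 with rfl | hf
  · simp
  have hη' : ∀ᵐ x, |∫ y, (v.toFun (x, y) - w.toFun (x, y))| ≤ η := by
    filter_upwards [hη, v.integrable_toFun.prod_right_ae, w.integrable_toFun.prod_right_ae]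
      with x hx hv hw
    rw [integral_sub hv hw]
    exact hx
  have h := neg_le_integral_kernel_energy (ν := (volume : Measure I))
    (u := fun p => v.toFun p - w.toFun p) (v.aemeasurable.sub w.aemeasurable) (w.abs_sub_le v)
    (by filter_upwards [v.symm, w.symm] with p h1 h2; rw [h1, h2])
    (fun S T hS hT => (w.abs_setIntegral_le_cutNorm v hS hT).trans hc) hη' (Lp.memLp f)
    (norm_pos_iff.2 hf) (sq_norm_eq_integral f).symm hK
  have hi : ∀ g : Graphon, Integrable (fun p => g.toFun p * ‖f p.1 - f p.2‖ ^ 2)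
      (volume.prod volume) := fun g =>
    integrable_kernel_mul g.aemeasurable g.abs_toFun_le (integrable_norm_sub_sq (Lp.memLp f))
  simp only [sub_mul] at h
  rw [integral_sub (hi v) (hi w)] at h
  rw [re_inner_laplacian, re_inner_laplacian]
  linarith

/-- The Laplacian annihilates constants, and `‖L^{1/2} 1‖² = ⟪L 1, 1⟫`. -/
theorem operatorSqrt_laplacianOn_const_one (w : Graphon) (S : Set I) :
    operatorSqrt (w.laplacianOn S) (Lp.const 2 (volume.restrict S) (1 : ℂ)) = 0 := by
  have h := norm_operatorSqrt_sq (w.laplacianOn_isPositive S)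
    (Lp.const 2 (volume.restrict S) (1 : ℂ))
  rw [laplacianOn, kernelLaplacian_const_one, inner_zero_left, Complex.zero_re] at h
  exact norm_eq_zero.1 (pow_eq_zero_iff two_ne_zero |>.1 h)

/-- The left side is half the energy over `S × S`. Nonnegativity of the integrand allows `y` to
range over all of `[0,1]`, which makes the bounds for the blocks of a partition add up to the total
energy. -/
theorem sq_norm_operatorSqrt_restrictLp_le (w : Graphon) (S : Set I)
    (f : Lp ℂ 2 (volume : Measure I)) :
    ‖operatorSqrt (w.laplacianOn S) (restrictLp S f)‖ ^ 2 ≤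
      1 / 2 * ∫ x in S, ∫ y, w.toFun (x, y) * ‖f x - f y‖ ^ 2 := by
  have hi : Integrable (fun p : I × I => w.toFun p * ‖f p.1 - f p.2‖ ^ 2)
      (volume.prod volume) :=
    integrable_kernel_mul w.aemeasurable w.abs_toFun_le (integrable_norm_sub_sq (Lp.memLp f))
  have hiS : Integrable (fun p : I × I => w.toFun p * ‖f p.1 - f p.2‖ ^ 2)
      ((volume.restrict S).prod (volume.restrict S)) := by
    rw [Measure.prod_restrict]; exact hi.restrict
  rw [norm_operatorSqrt_sq (w.laplacianOn_isPositive S), laplacianOn,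
    inner_kernelLaplacian_self _ _ (w.laplacianOn_symm S), Complex.ofReal_re]
  have h1 : ∫ p, w.toFun p * ‖restrictLp S f p.1 - restrictLp S f p.2‖ ^ 2
      ∂((volume.restrict S).prod (volume.restrict S)) =
      ∫ p, w.toFun p * ‖f p.1 - f p.2‖ ^ 2
        ∂((volume.restrict S).prod (volume.restrict S)) := by
    refine integral_congr_ae ?_
    filter_upwards [Measure.quasiMeasurePreserving_fst.ae (restrictLp_ae_eq S f),
      Measure.quasiMeasurePreserving_snd.ae (restrictLp_ae_eq S f)] with p hp1 hp2
    rw [hp1, hp2]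
  rw [h1, integral_prod _ hiS]
  refine mul_le_mul_of_nonneg_left ?_ (by norm_num)
  refine integral_mono_ae hiS.integral_prod_left hi.integral_prod_left.restrict ?_
  filter_upwards [ae_restrict_of_ae hi.prod_right_ae] with x hx
  exact setIntegral_le_integral hx
    (ae_of_all _ fun y => mul_nonneg (w.mem_Icc _).1 (sq_nonneg _))

theorem sum_sq_norm_operatorSqrt_restrictLp_le (w : Graphon) {ι : Type*} [Fintype ι]
    {S : ι → Set I} (hS : ∀ j, NullMeasurableSet (S j) volume)
    (hd : Pairwise fun i j => Disjoint (S i) (S j)) (hU : ⋃ j, S j = Set.univ)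
    (f : Lp ℂ 2 (volume : Measure I)) :
    ∑ j, ‖operatorSqrt (w.laplacianOn (S j)) (restrictLp (S j) f)‖ ^ 2 ≤
      (⟪w.laplacian f, f⟫_ℂ).re := by
  have hi : Integrable (fun p : I × I => w.toFun p * ‖f p.1 - f p.2‖ ^ 2)
      (volume.prod volume) :=
    integrable_kernel_mul w.aemeasurable w.abs_toFun_le (integrable_norm_sub_sq (Lp.memLp f))
  refine (Finset.sum_le_sum fun j _ => w.sq_norm_operatorSqrt_restrictLp_le (S j) f).trans ?_
  rw [← Finset.mul_sum, re_inner_laplacian, integral_prod _ hi,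
    sum_setIntegral_eq_integral hS hd hU hi.integral_prod_left]

/-- The sampling inequality for a single graphon and functions with bounded Rayleigh quotient. -/
theorem sampling_lower_bound (w : Graphon) {ι : Type*} [Fintype ι]
    {S : ι → Set I} (hS : ∀ j, NullMeasurableSet (S j) volume)
    (hd : Pairwise fun i j => Disjoint (S i) (S j)) (hU : ⋃ j, S j = Set.univ)
    {ψ : ∀ j, Lp ℂ 2 (volume.restrict (S j))} (hψ : ∀ j, ‖ψ j‖ = 1)
    (hψi : ∀ j, ∫ x in S j, ψ j x ≠ 0) {δ θ γ : ℝ} (hδ : 0 < δ) (hθ : 0 < θ)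
    (hθj : ∀ j, samplingConst (S j) (ψ j) ≤ θ)
    (hP : ∀ j, ∀ f : Lp ℂ 2 (volume.restrict (S j)), ∫ x in S j, f x = 0 →
      δ * ‖f‖ ≤ ‖operatorSqrt (w.laplacianOn (S j)) f‖)
    (hγ : 0 ≤ γ) (hθγ : √(θ * γ) ≤ δ) {f : Lp ℂ 2 (volume : Measure I)}
    (hf : (⟪w.laplacian f, f⟫_ℂ).re ≤ γ * ‖f‖ ^ 2) :
    (δ - √(θ * γ)) ^ 2 / (θ * δ ^ 2) * ‖f‖ ^ 2 ≤ ∑ j, ‖sample (S j) f (ψ j)‖ ^ 2 := by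
  have hsq : √(θ * γ) = √θ * √γ := Real.sqrt_mul hθ.le γ
  have hlocal : ∀ j, ‖restrictLp (S j) f‖ ≤ √θ * ‖sample (S j) f (ψ j)‖ +
      √θ / δ * ‖operatorSqrt (w.laplacianOn (S j)) (restrictLp (S j) f)‖ := fun j => by
    rw [sample_eq_inner]
    refine norm_le_sample_add_of_poincare (operatorSqrt (w.laplacianOn (S j)))
      (e := Lp.const 2 (volume.restrict (S j)) (1 : ℂ)) (hψ j) ?_
      (w.operatorSqrt_laplacianOn_const_one (S j)) hδ (fun h hh => hP j h ?_) ?_ _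
    · rw [inner_const_one]; exact hψi j
    · rwa [inner_const_one] at hh
    · rw [inner_const_one, sq_norm_const_one, measureReal_restrict_apply_univ]
      exact hθj j
  have hE : ∑ j, ‖operatorSqrt (w.laplacianOn (S j)) (restrictLp (S j) f)‖ ^ 2 ≤
      (√γ * ‖f‖) ^ 2 := by
    rw [mul_pow, Real.sq_sqrt hγ]
    exact (w.sum_sq_norm_operatorSqrt_restrictLp_le hS hd hU f).trans hf
  have hβE : √θ / δ * (√γ * ‖f‖) = √(θ * γ) / δ * ‖f‖ := by rw [hsq]; ring
  -- Here `N = ‖f‖`, `α = √θ`, `β = √θ / δ` and `E = √γ ‖f‖`; the requirement `β E ≤ N` is exactly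
  -- `√(θ γ) ≤ δ`.
  have h := sq_le_sum_sq_of_local_bounds (fun j => norm_nonneg _) (Real.sqrt_nonneg θ)
    (by positivity : 0 ≤ √θ / δ) hlocal (sum_sq_norm_restrictLp hS hd hU f) hE (by positivity)
    (by
      rw [hβE]
      exact mul_le_of_le_one_left (norm_nonneg _) ((div_le_one hδ).2 hθγ))
  rw [hβE, Real.sq_sqrt hθ.le] at h
  have e : (δ - √(θ * γ)) ^ 2 / (θ * δ ^ 2) * ‖f‖ ^ 2 =
      (‖f‖ - √(θ * γ) / δ * ‖f‖) ^ 2 / θ := by field_simp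
  rw [e, div_le_iff₀' hθ]
  exact h

end Graphon

theorem sum_sq_norm_sample_le {ι : Type*} [Fintype ι]
    {S : ι → Set I} (hS : ∀ j, NullMeasurableSet (S j) volume)
    (hd : Pairwise fun i j => Disjoint (S i) (S j)) (hU : ⋃ j, S j = Set.univ)
    {ψ : ∀ j, Lp ℂ 2 (volume.restrict (S j))} (hψ : ∀ j, ‖ψ j‖ = 1)
    (f : Lp ℂ 2 (volume : Measure I)) : ∑ j, ‖sample (S j) f (ψ j)‖ ^ 2 ≤ ‖f‖ ^ 2 := by
  rw [← sum_sq_norm_restrictLp hS hd hU f]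
  refine Finset.sum_le_sum fun j _ => pow_le_pow_left₀ (norm_nonneg _) ?_ 2
  rw [sample_eq_inner]
  simpa [hψ j] using norm_inner_le_norm (𝕜 := ℂ) (ψ j) (restrictLp (S j) f)

end

/-! ### The sampling theorem: choice of parameters -/

theorem mainTheorem1 (w : Graphon) (wn : ℕ → Graphon)
    (hcut : Tendsto (fun n => cutNorm (fun p => (wn n).toFun p - w.toFun p)) atTop (𝓝 0))
    (hdeg : Tendsto (fun n => eLpNorm (fun x => (wn n).degree x - w.degree x) ∞ volume)
      atTop (𝓝 0))
    (k : ℕ) (S : Fin k → Set I) (hSmeas : ∀ j, NullMeasurableSet (S j) volume)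
    (hSdisj : Pairwise fun i j => Disjoint (S i) (S j)) (hScover : ⋃ j, S j = Set.univ)
    (ψ : ∀ j, Lp ℂ 2 (volume.restrict (S j))) (hψnorm : ∀ j, ‖ψ j‖ = 1)
    (hψint : ∀ j, ∫ x in S j, ψ j x ≠ 0)
    (δ : Fin k → ℝ) (hδpos : ∀ j, 0 < δ j)
    (hδ : ∀ j, ∀ f : Lp ℂ 2 (volume.restrict (S j)), ∫ x in S j, f x = 0 →
      δ j * ‖f‖ ≤ ‖operatorSqrt (w.laplacianOn (S j)) f‖)
    (γ : ℝ) (hγpos : 0 < γ) (hγ : γ < (⨅ j, δ j) ^ 2 / ⨆ j, samplingConst (S j) (ψ j)) :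
    ∃ N : ℕ, ∀ n ≥ N, ∀ f ∈ (wn n).paleyWiener γ,
      ((⨅ j, δ j) - √((⨆ j, samplingConst (S j) (ψ j)) * γ)) ^ 2 /
            (2 * (⨆ j, samplingConst (S j) (ψ j)) * (⨅ j, δ j) ^ 2) * ‖f‖ ^ 2 ≤
          ∑ j, ‖sample (S j) f (ψ j)‖ ^ 2 ∧
        ∑ j, ‖sample (S j) f (ψ j)‖ ^ 2 ≤ ‖f‖ ^ 2 := by
  set θ := ⨆ j, samplingConst (S j) (ψ j)
  set δ₀ := ⨅ j, δ j
  have hδ₀nonneg : 0 ≤ δ₀ := Real.iInf_nonneg fun j => (hδpos j).le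
  -- Positivity of `δ₀` and `θ` is read off from `0 < γ < δ₀² / θ`. This also covers an empty index
  -- set, where both extrema are `0` by convention and the assumption on `γ` fails.
  have hdiv : 0 < δ₀ ^ 2 / θ := hγpos.trans hγ
  have hδ₀ : 0 < δ₀ := hδ₀nonneg.lt_of_ne' fun h => by simp [h] at hdiv
  have hθ : 0 < θ := (div_pos_iff_of_pos_left (by positivity)).1 hdiv
  have hθj : ∀ j, samplingConst (S j) (ψ j) ≤ θ := le_ciSup (Set.finite_range _).bddAbove
  have hδj : ∀ j, δ₀ ≤ δ j := ciInf_le (Set.finite_range _).bddBelow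
  have hlt : √(θ * γ) < δ₀ := (Real.sqrt_lt' hδ₀).2 ((lt_div_iff₀' hθ).1 hγ)
  obtain ⟨ε, hε, hεlt, hεhalf⟩ := exists_pos_half_sq_le hlt
  -- The form error `η + 2 (4 K² c + 2 / K)` is to equal `ε`: `K = 12 / ε`, `c = ε / (24 K²)` and `η
  -- = ε / 3` make each of its three terms `ε / 3`. Since `K` is fixed before `c`, the index `N`
  -- depends on neither `n` nor `f`.
  set K : ℝ := 12 / ε with hK
  have hKpos : 0 < K := by positivity
  have hc : (0 : ℝ) < ε / (24 * K ^ 2) := by positivity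
  have hη : (0 : ℝ≥0∞) < ENNReal.ofReal (ε / 3) := ENNReal.ofReal_pos.2 (by positivity)
  obtain ⟨N, hN⟩ := eventually_atTop.1
    ((hcut.eventually (ge_mem_nhds hc)).and (hdeg.eventually (ge_mem_nhds hη)))
  refine ⟨N, fun n hn f hf => ⟨?_, sum_sq_norm_sample_le hSmeas hSdisj hScover hψnorm f⟩⟩
  obtain ⟨hcn, hdn⟩ := hN n hn
  have hdeg_n : ∀ᵐ x, |(wn n).degree x - w.degree x| ≤ ε / 3 := by
    rw [eLpNorm_exponent_top] at hdn
    filter_upwards [ae_le_eLpNormEssSup (μ := (volume : Measure I))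
      (f := fun x => (wn n).degree x - w.degree x)] with x hx
    have h := hx.trans hdn
    rwa [Real.enorm_eq_ofReal_abs, ENNReal.ofReal_le_ofReal_iff (by positivity)] at h
  have hconst : ε / 3 + 2 * (4 * K ^ 2 * (ε / (24 * K ^ 2)) + 2 / K) = ε := by
    rw [hK]; field_simp; norm_num
  have hform := w.re_inner_laplacian_le_add (wn n) hKpos hcn hdeg_n f
  rw [hconst] at hform
  have hray := re_inner_le_of_mem_range_spectralProjection
    (wn n).laplacian_isPositive.isSelfAdjoint hγpos.le hf
  -- The inequality is applied to the limit `w`, not to `w_n`, since the Poincaré hypothesis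
  -- concerns `w`; the Rayleigh quotient bound `γ + ε` comes from adding `hform` and `hray`.
  have hmain := w.sampling_lower_bound hSmeas hSdisj hScover hψnorm hψint hδ₀ hθ hθj
    (fun j g hg => (mul_le_mul_of_nonneg_right (hδj j) (norm_nonneg g)).trans (hδ j g hg))
    (γ := γ + ε) (by positivity) hεlt.le (f := f) (by linarith)
  refine le_trans ?_ hmain
  refine mul_le_mul_of_nonneg_right ?_ (sq_nonneg _)
  calc (δ₀ - √(θ * γ)) ^ 2 / (2 * θ * δ₀ ^ 2)
      = (δ₀ - √(θ * γ)) ^ 2 / 2 / (θ * δ₀ ^ 2) := by field_simp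
    _ ≤ (δ₀ - √(θ * (γ + ε))) ^ 2 / (θ * δ₀ ^ 2) := by gcongr
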